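/- A *line* means any affine line in $\mathbb{R}^2$ (vertical ones included), and $\mathcal F_3$ denotes the family of all sets $L_1\cup L_2\cup L_3$ where $L_1,L_2,L_3$ are (not necessarily distinct) lines in $\mathbb{R}^2$. The family $\mathcal F_3$ *shatters* a set $P\subseteq\mathbb{R}^2$ if for every $Z\subseteq P$ there is $S\in\mathcal F_3$ with $S\cap P=Z$. **Theorem.** Let $P\subseteq\mathbb{R}^2$ be a set of exactly $9$ points that contains four distinct collinear points. Then $P$ is shattered by $\mathcal F_3$ if and only if all three of the following conditions hold: (O) $P$ is contained in the union of at most three lines; (A1) for every $A\subseteq P$ with $|A|=4$ there are distinct $a,a'\in A$ such that the line $l_{a,a'}$ through $a$ and $a'$ satisfies $l_{a,a'}\cap P\subseteq A$; (A2) for every line $l$ with $|l\cap P|\ge 4$ and every $x\in l\cap P$ there is a line $l'\neq l$ with $x\in l'$ and $|l'\cap P|\ge 3$. -/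

import Mathlib

/-- The Euclidean plane `ℝ²`. -/
abbrev Plane : Type := EuclideanSpace ℝ (Fin 2)

/-- The family `𝓕₁` of all lines in the plane, each regarded as a set of points. -/
def planeLines : Set (Set Plane) :=
  {l | ∃ L : AffineSubspace ℝ Plane, Module.finrank ℝ L.direction = 1 ∧ l = (L : Set Plane)}

/-- The `k`-fold union `𝓢^{∪k}` of a family of sets (repetitions allowed). -/
def kFoldUnion {X : Type*} (S : Set (Set X)) (k : ℕ) : Set (Set X) :=
  {U | ∃ f : Fin k → Set X, (∀ i, f i ∈ S) ∧ U = ⋃ i, f i}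

/-- The family `𝓕ₖ` of all unions of `k` lines in the plane. -/
def lineUnions (k : ℕ) : Set (Set Plane) := kFoldUnion planeLines k

/-- `Z ⊆ Y` is isolated (in `Y`) by the family `S`: some member of `S` meets `Y` exactly in `Z`. -/
def IsolatedBy {X : Type*} (S : Set (Set X)) (Y Z : Set X) : Prop :=
  ∃ T ∈ S, T ∩ Y = Z

/-- The family `S` shatters `Y`: every subset of `Y` is isolated by `S`. -/
def FamilyShatters {X : Type*} (S : Set (Set X)) (Y : Set X) : Prop :=
  ∀ Z ⊆ Y, IsolatedBy S Y Z

/-- The points `a, b` pair inside `A` (with respect to `P`): the line through `a` and `b` meets `P`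
only in points of `A`. Used for distinct `a, b ∈ A` and `A ⊆ P`. -/
def PairInside (P A : Set Plane) (a b : Plane) : Prop :=
  (affineSpan ℝ {a, b} : Set Plane) ∩ P ⊆ A

/-- Condition (O): `P` is covered by at most three lines. -/
def CondO (P : Set Plane) : Prop :=
  ∃ C : Finset (Set Plane), (∀ l ∈ C, l ∈ planeLines) ∧ C.card ≤ 3 ∧ ∀ p ∈ P, ∃ l ∈ C, p ∈ l

/-- Condition (A1): every `4`-element subset `A` of `P` contains two distinct points that pair
inside `A`. -/
def CondA1 (P : Set Plane) : Prop :=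
  ∀ A ⊆ P, A.ncard = 4 → ∃ a ∈ A, ∃ b ∈ A, a ≠ b ∧ PairInside P A a b

/-- Condition (A2): every point of `P` on a line `l` meeting `P` in at least four points lies on
another line meeting `P` in at least three points. -/
def CondA2 (P : Set Plane) : Prop :=
  ∀ l ∈ planeLines, 4 ≤ (l ∩ P).ncard → ∀ x ∈ l ∩ P,
    ∃ l' ∈ planeLines, l' ≠ l ∧ x ∈ l' ∧ 3 ≤ (l' ∩ P).ncard

/-!
Let `l` be a line with at least four points of `P`. Both sides of the equivalence give (O) and (A1):
for (O) isolate `P` itself, for (A1) isolate `A` and apply the pigeonhole principle to its four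
points and the three lines. Both sides also bound every line by four points of `P`. Under shattering
a line with five points cannot lose just one of them (`ncard_inter_le_four_of_shatters`). Under (A1)
and (A2) one counts incidences: every point of a line `l` with `k ≥ 5` points lies on another line
with at least two points off `l`, while a point `p` off `l` is on at most two of these lines, since
otherwise `p` and three points of `l` violate (A1) (`no_three_rich_joins`); so `2k ≤ 2(9 - k)`.

It remains to show that (A2) and shattering are equivalent given (O), (A1) and this bound. By (O) some
line `m` carries three of the five points off `l` (`exists_second_line`). Label `P` by `Fin 9` so that
`l` carries the points `0, 1, 2, 3` and `m` carries `6, 7, 8`, and encode the trace of a line on `P`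
as a nine-bit number. The traces form a linear space on nine points, that is, two points lie in
exactly one trace of size at least two, and this is all that the rest of the proof uses: the
equivalence holds for every linear space satisfying the constraints collected in
`Mask.IsTraceFamily`. The space is determined by its blocks, the traces with at least three points.
A verified backtracking search (`Mask.search_sound`, evaluated in `Mask.search_leaf`) runs through all
families of blocks. It is kept small by three conditions on a partial family: two blocks share at most
one point; a point off `l` is joined by blocks to at most two points of `l`; and the labels
`0, 1, 2, 3` are sorted, each by the largest block through it (`Mask.exists_labelling`). At a leaf the
family is complete, and the two properties are compared by computation.
-/

/-! ### Subsets of nine points as bit masks, and the search over block families -/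

namespace Mask

/-- The number of elements of the subset of `{0, …, 8}` encoded by the bits of `b`, for `b < 512`.
Written out as a sum so that the kernel evaluates it fast. -/
def size (b : ℕ) : ℕ :=
  (b &&& 1) + ((b >>> 1 &&& 1) + ((b >>> 2 &&& 1) + ((b >>> 3 &&& 1) + ((b >>> 4 &&& 1) +
    ((b >>> 5 &&& 1) + ((b >>> 6 &&& 1) + ((b >>> 7 &&& 1) + (b >>> 8 &&& 1))))))))

/-- Whether `b` has at most one bit: clearing the lowest bit of `b` leaves `0`. -/
def atMostOne (b : ℕ) : Bool := (b &&& (b - 1)).beq 0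

/-- The points of the base line (the bits of `15`) that lie in a common member of `cur` with the
point `p`. -/
def contacts (p : ℕ) (cur : List ℕ) : ℕ :=
  cur.foldr (fun c u => (cond (c.testBit p) (c &&& 15) 0) ||| u) 0

/-- Necessary conditions for adding the block `b` to a family `cur` that already contains all larger
blocks. With the *colour* of `b` being the point of the base line `15` on it, these are: `b` meets each
member of `cur` in at most one point; if the colour of `b` is `i < 3`, then a larger block of colour
`i + 1` is present; no point off the base line is in contact with more than two of its points. -/
def admissible (b : ℕ) (cur : List ℕ) : Bool :=
  cur.all (fun c => atMostOne (b &&& c)) &&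
  ((b &&& 15 == 0) || (b &&& 15 == 8) ||
    cur.any (fun c => (c &&& 15 == 2 * (b &&& 15)) && b.blt c)) &&
  [4, 5, 6, 7, 8].all (fun p => (size (contacts p (b :: cur))).ble 2)

/-- The possible blocks other than the base line `15` and the block containing `{6, 7, 8}`, in
descending order. Such a block does not contain `{6, 7, 8}`, so it is less than `448`. -/
def candidates : List ℕ :=
  (List.range 448).reverse.filter fun b =>
    Nat.ble 3 (size b) && Nat.ble (size b) 4 && atMostOne (b &&& 15)

/-- Whether `leaf` holds for all families that extend `cur` by members of the given list, each member
being admissible when it is added. -/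
def search (leaf : List ℕ → Bool) : List ℕ → List ℕ → Bool
  | [], cur => leaf cur
  | b :: rest, cur =>
    search leaf rest cur && (!(admissible b cur) || search leaf rest (b :: cur))

/-- The members of the linear space on nine points with the blocks `cur`: the blocks, the sets with at
most one point, and the pairs of points that are in no block. -/
def traces (cur : List ℕ) : List ℕ :=
  cur ++ ((List.range 512).filter fun b => (size b).ble 2).filter
    (fun b => (size b).ble 1 || cur.all fun c => atMostOne (b &&& c))

/-- Bitwise disjunction of the values `f a`, `a ∈ L`. -/
def union (L : List ℕ) (f : ℕ → ℕ) : ℕ := L.foldr (fun a X => f a ||| X) 0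

/-- A family of subsets of `{0, …, 8}` is encoded as a number with `512` bits, bit `u` telling whether
the subset with mask `u` belongs to it. This is the family of all subsets that do not contain `i`: its
bits repeat `2 ^ i` ones followed by `2 ^ i` zeros. -/
def lacking (i : ℕ) : ℕ := (1 <<< 512 - 1) / (1 <<< (1 <<< i) + 1)

/-- The family of all `u ∪ {i}`, `u ∈ X`: members containing `i` stay, the others move up by
`2 ^ i` places. -/
def adjoinBit (i X : ℕ) : ℕ :=
  (X &&& lacking i <<< (1 <<< i)) ||| (X &&& lacking i) <<< (1 <<< i)

/-- The family of all `u ∪ c`, `u ∈ X`. -/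
def adjoin (c X : ℕ) : ℕ :=
  (List.range 9).foldr (fun i Y => cond (c.testBit i) (adjoinBit i Y) Y) X

/-- The family of all `u ∪ c`, `u ∈ X`, `c ∈ L`. -/
def joins (L : List ℕ) (X : ℕ) : ℕ := union L fun c => adjoin c X

/-- Whether every subset of `{0, …, 8}` is a union of three members of `L`. The number `1` encodes the
family whose only member is the empty set. -/
def covers (L : List ℕ) : Bool :=
  (joins L (joins L (joins L 1)) &&& (1 <<< 512 - 1)).beq (1 <<< 512 - 1)

/-- Condition (A2) for the linear space with blocks `cur`. -/
def doublyRich (cur : List ℕ) : Bool :=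
  cur.all fun l => (size l).ble 3 || (List.range 9).all fun i =>
    !l.testBit i || cur.any fun c => !(c.beq l) && c.testBit i

/-- Condition (A1) for the linear space with members `L`. -/
def pairing (L : List ℕ) : Bool :=
  ((List.range 512).filter fun A => (size A).beq 4).all fun A =>
    L.any fun b => Nat.ble 2 (size b) && (b &&& A).beq b

/-- In the linear space with blocks `cur`, condition (A1) implies that (A2) is equivalent to shattering.
If (A2) fails, shattering fails without recourse to (A1). -/
def leaf (cur : List ℕ) : Bool :=
  if doublyRich cur then !(pairing (traces cur)) || covers (traces cur)
  else !(covers (traces cur))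

set_option exponentiation.threshold 600
/-- The finite verification. The numbers `448 + x` listed are the masks of a line through the points
`6, 7, 8` and at most one further point. -/
theorem search_leaf : ([448, 449, 450, 452, 456, 464, 480].all fun m =>
    !(admissible m [15]) || search leaf candidates [m, 15]) = true := by decide +kernel
end Mask

/-! ### The computed test for shattering -/

namespace Mask

set_option exponentiation.threshold 600

/-- The properties of the family of traces of lines on nine labelled points that the search uses. The
first four say that the family is a linear space containing all sets with at most one point; `base` and
`second` fix the lines through `0, 1, 2, 3` and through `6, 7, 8` (numbers from `448` up to `511` are the
masks containing `6, 7, 8`); `sorted` says that the labels on the base line are ordered by the largest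
block through them; `contact` is the consequence of (A1) for points off the base line. -/
structure IsTraceFamily (T : ℕ → Prop) : Prop where
  lt : ∀ b, T b → b < 512
  small : ∀ b < 512, size b ≤ 1 → T b
  join : ∀ b < 512, size b = 2 → ∃ c, T c ∧ b &&& c = b
  unique : ∀ b c, T b → T c → 2 ≤ size (b &&& c) → b = c
  base : T 15
  le_four : ∀ b, T b → size b ≤ 4
  second : ∃ b, T b ∧ 448 ≤ b
  sorted : ∀ b, T b → 3 ≤ size b → b &&& 15 = 1 ∨ b &&& 15 = 2 ∨ b &&& 15 = 4 →
    ∃ c, T c ∧ 3 ≤ size c ∧ c &&& 15 = 2 * (b &&& 15) ∧ b < c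
  contact : ∀ p, 4 ≤ p → p < 9 → ∀ t < 16,
    (∀ i, t.testBit i → ∃ b, T b ∧ 3 ≤ size b ∧ b.testBit p ∧ b.testBit i) → size t ≤ 2

/-- Condition (A1) for a family of masks. -/
def Pairing (T : ℕ → Prop) : Prop :=
  ∀ A < 512, size A = 4 → ∃ b, T b ∧ 2 ≤ size b ∧ b &&& A = b

/-- Condition (A2) for a family of masks. -/
def DoublyRich (T : ℕ → Prop) : Prop :=
  ∀ l, T l → 4 ≤ size l → ∀ i < 9, l.testBit i →
    ∃ c, T c ∧ 3 ≤ size c ∧ c ≠ l ∧ c.testBit i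

/-- Shattering for a family of masks: every subset of `{0, …, 8}` is a union of three members. -/
def Covers (T : ℕ → Prop) : Prop :=
  ∀ Z < 512, ∃ a b c, T a ∧ T b ∧ T c ∧ a ||| (b ||| c) = Z

theorem testBit_union (L : List ℕ) (f : ℕ → ℕ) (Z : ℕ) :
    (union L f).testBit Z ↔ ∃ a ∈ L, (f a).testBit Z := by
  induction L with
  | nil => simp [union]
  | cons a L ih =>
    simp only [union, List.foldr_cons, Nat.testBit_or, Bool.or_eq_true, List.mem_cons,
      exists_eq_or_imp] at ih ⊢
    rw [ih]

theorem and_lt {b : ℕ} (hb : b < 512) (c : ℕ) : b &&& c < 512 :=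
  lt_of_le_of_lt Nat.and_le_left hb

theorem atMostOne_iff {b : ℕ} (hb : b < 512) : atMostOne b = true ↔ size b ≤ 1 := by
  have : ∀ b < 512, atMostOne b = true ↔ size b ≤ 1 := by decide +kernel
  exact this b hb

theorem testBit_lacking {i u : ℕ} (hi : i < 9) (hu : u < 512) :
    (lacking i).testBit u = !u.testBit i := by
  have : ∀ i < 9, ∀ u < 512, (lacking i).testBit u = !u.testBit i := by decide +kernel
  exact this i hi u hu

theorem testBit_having {i u : ℕ} (hi : i < 9) (hu : u < 512) :
    (lacking i <<< (1 <<< i)).testBit u = u.testBit i := by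
  have : ∀ i < 9, ∀ u < 512, (lacking i <<< (1 <<< i)).testBit u = u.testBit i := by
    decide +kernel
  exact this i hi u hu

theorem or_bit {i u : ℕ} (hi : i < 9) (hu : u < 512) :
    u ||| 1 <<< i = if u.testBit i then u else u + 1 <<< i := by
  have : ∀ i < 9, ∀ u < 512, u ||| 1 <<< i = if u.testBit i then u else u + 1 <<< i := by
    decide +kernel
  exact this i hi u hu

theorem testBit_adjoinBit {i X Z : ℕ} (hi : i < 9) (hZ : Z < 512) :
    (adjoinBit i X).testBit Z ↔ ∃ u < 512, X.testBit u ∧ u ||| 1 <<< i = Z := by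
  simp only [adjoinBit, Nat.testBit_or, Nat.testBit_and, Nat.testBit_shiftLeft (_ &&& _),
    testBit_having hi hZ, Bool.or_eq_true, Bool.and_eq_true, decide_eq_true_eq]
  constructor
  · rintro (⟨h1, h2⟩ | ⟨h1, h2, h3⟩)
    · exact ⟨Z, hZ, h1, by rw [or_bit hi hZ, if_pos h2]⟩
    · have hu : Z - 1 <<< i < 512 := (Nat.sub_le _ _).trans_lt hZ
      rw [testBit_lacking hi hu, Bool.not_eq_true'] at h3
      refine ⟨_, hu, h2, ?_⟩
      rw [or_bit hi hu, if_neg (by simp [h3])]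
      exact Nat.sub_add_cancel h1
  · rintro ⟨u, hu, hX, rfl⟩
    rw [or_bit hi hu]
    by_cases h : u.testBit i
    · exact Or.inl (by simp [h, hX])
    · right
      simp only [if_neg h, Nat.add_sub_cancel, hX, testBit_lacking hi hu]
      simp [h]

theorem testBit_adjoin {c X Z : ℕ} (hc : c < 512) (hZ : Z < 512) :
    (adjoin c X).testBit Z ↔ ∃ u < 512, X.testBit u ∧ u ||| c = Z := by
  have key : ∀ l : List ℕ, (∀ i ∈ l, i < 9) → ∀ Z < 512,
      ((l.foldr (fun i Y => cond (c.testBit i) (adjoinBit i Y) Y) X).testBit Z ↔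
        ∃ u < 512, X.testBit u ∧
          u ||| l.foldr (fun i m => cond (c.testBit i) (1 <<< i ||| m) m) 0 = Z) := by
    intro l
    induction l with
    | nil => intro _ Z hZ; simpa using fun _ => hZ
    | cons i l ih =>
      intro hl Z hZ
      have hi := hl i (by simp)
      have ih' := ih fun j hj => hl j (by simp [hj])
      cases hci : c.testBit i
      · simp only [List.foldr_cons, hci, cond_false]
        exact ih' Z hZ
      · simp only [List.foldr_cons, hci, cond_true]
        rw [testBit_adjoinBit hi hZ]
        constructor
        · rintro ⟨v, hv, h1, rfl⟩
          obtain ⟨u, hu, h2, rfl⟩ := (ih' v hv).1 h1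
          exact ⟨u, hu, h2, by ac_rfl⟩
        · rintro ⟨u, hu, h1, rfl⟩
          have hv : u ||| l.foldr (fun i m => cond (c.testBit i) (1 <<< i ||| m) m) 0 < 512 := by
            refine lt_of_le_of_lt ?_ hZ
            rw [← Nat.or_assoc, Nat.or_right_comm]
            exact Nat.left_le_or
          exact ⟨_, hv, (ih' _ hv).2 ⟨u, hu, h1, rfl⟩, by ac_rfl⟩
  have hm : ∀ c < 512,
      (List.range 9).foldr (fun i m => cond (c.testBit i) (1 <<< i ||| m) m) 0 = c := by
    decide +kernel
  rw [adjoin, key _ (fun i hi => List.mem_range.1 hi) Z hZ, hm c hc]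

theorem testBit_joins {L : List ℕ} {X Z : ℕ} (hL : ∀ c ∈ L, c < 512) (hZ : Z < 512) :
    (joins L X).testBit Z ↔ ∃ c ∈ L, ∃ u < 512, X.testBit u ∧ u ||| c = Z := by
  rw [joins, testBit_union]
  exact exists_congr fun c => and_congr_right fun hc => testBit_adjoin (hL c hc) hZ

/-- The bit-parallel computation `covers` decides `Covers`. -/
theorem covers_iff {L : List ℕ} {T : ℕ → Prop} (hL : ∀ b, T b ↔ b ∈ L) (hlt : ∀ b, T b → b < 512) :
    covers L = true ↔ Covers T := by
  have hL' : ∀ c ∈ L, c < 512 := fun c hc => hlt c ((hL c).2 hc)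
  have hfull : ((1 <<< 512 - 1 : ℕ)) = 2 ^ 512 - 1 := by rw [Nat.one_shiftLeft]
  have h3 : ∀ Z < 512, (joins L (joins L (joins L 1))).testBit Z ↔
      ∃ a b c, T a ∧ T b ∧ T c ∧ a ||| (b ||| c) = Z := by
    intro Z hZ
    rw [testBit_joins hL' hZ]
    constructor
    · rintro ⟨a, ha, u, hu, h1, rfl⟩
      obtain ⟨b, hb, v, hv, h2, rfl⟩ := (testBit_joins hL' hu).1 h1
      obtain ⟨c, hc, w, hw, h, rfl⟩ := (testBit_joins hL' hv).1 h2
      -- bit `w` of the number `1` is set only for `w = 0`, the empty union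
      have hw0 : w = 0 := by
        rw [show (1 : ℕ) = 2 ^ 0 from rfl, Nat.testBit_two_pow] at h
        exact (by simpa using h : 0 = w).symm
      subst hw0
      refine ⟨a, b, c, (hL a).2 ha, (hL b).2 hb, (hL c).2 hc, ?_⟩
      rw [Nat.zero_or]; ac_rfl
    · rintro ⟨a, b, c, ha, hb, hc, rfl⟩
      have hc5 := hlt c hc
      have hbc : c ||| b < 512 := Nat.or_lt_two_pow (n := 9) hc5 (hlt b hb)
      refine ⟨a, (hL a).1 ha, c ||| b, hbc, ?_, by ac_rfl⟩
      refine (testBit_joins hL' hbc).2 ⟨b, (hL b).1 hb, c, hc5, ?_, rfl⟩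
      exact (testBit_joins hL' hc5).2 ⟨c, (hL c).1 hc, 0, by norm_num, by decide, by simp⟩
  rw [covers, Nat.beq_eq, hfull]
  constructor
  · intro h Z hZ
    rw [← h3 Z hZ]
    have := congrArg (fun x => x.testBit Z) h
    simpa only [Nat.testBit_and, Nat.testBit_two_pow_sub_one, hZ, decide_true, Bool.and_true]
      using this
  · intro h
    refine Nat.eq_of_testBit_eq fun Z => ?_
    rw [Nat.testBit_and, Nat.testBit_two_pow_sub_one]
    by_cases hZ : Z < 512
    · simp [hZ, (h3 Z hZ).2 (h Z hZ)]
    · simp [hZ]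

end Mask

/-! ### Soundness of the search -/

namespace Mask

/-- A linear space is determined by its blocks. -/
theorem mem_traces_iff {T : ℕ → Prop} (hT : IsTraceFamily T) {cur : List ℕ}
    (hcur : ∀ b, b ∈ cur ↔ T b ∧ 3 ≤ size b) (b : ℕ) : T b ↔ b ∈ traces cur := by
  have hsub : ∀ b ∈ (List.range 512).filter (fun b => (size b).ble 2),
      ∀ c ∈ (List.range 512).filter (fun b => (size b).ble 2),
        size b = 2 → b &&& c = b → b = c := by decide +kernel
  simp only [List.mem_filter, List.mem_range, Nat.ble_eq] at hsub
  simp only [traces, List.mem_append, List.mem_filter, List.mem_range, Nat.ble_eq,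
    Bool.or_eq_true, List.all_eq_true]
  constructor
  · intro hb
    by_cases h3 : 3 ≤ size b
    · exact Or.inl ((hcur b).2 ⟨hb, h3⟩)
    · refine Or.inr ⟨⟨hT.lt b hb, by omega⟩, Or.inr fun c hc => ?_⟩
      rw [atMostOne_iff (and_lt (hT.lt b hb) c)]
      by_contra h
      obtain ⟨hcT, hc3⟩ := (hcur c).1 hc
      exact h3 (hT.unique b c hb hcT (by omega) ▸ hc3)
  · rintro (hb | ⟨⟨hb, h2⟩, h⟩)
    · exact ((hcur b).1 hb).1
    · by_cases h1 : size b ≤ 1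
      · exact hT.small b hb h1
      · have hb2 : size b = 2 := by omega
        obtain ⟨c, hc, hbc⟩ := hT.join b hb hb2
        by_cases hc3 : 3 ≤ size c
        · have := (h.resolve_left h1) c ((hcur c).2 ⟨hc, hc3⟩)
          rw [atMostOne_iff (and_lt hb c), hbc] at this
          omega
        · rw [hsub b ⟨hb, h2⟩ c ⟨hT.lt c hc, by omega⟩ hb2 hbc]
          exact hc

theorem doublyRich_iff {T : ℕ → Prop} {cur : List ℕ}
    (hcur : ∀ b, b ∈ cur ↔ T b ∧ 3 ≤ size b) : doublyRich cur = true ↔ DoublyRich T := by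
  simp only [doublyRich, List.all_eq_true, Bool.or_eq_true, List.any_eq_true, Nat.ble_eq,
    List.mem_range, Bool.and_eq_true, Bool.not_eq_true', hcur, DoublyRich]
  constructor
  · intro h l hl h4 i hi hli
    obtain hc | ⟨c, hc, h1, h2⟩ := ((h l ⟨hl, by omega⟩).resolve_left (by omega)) i hi
    · simp [hc] at hli
    · exact ⟨c, hc.1, hc.2, fun e => by simp [e] at h1, h2⟩
  · rintro h l ⟨hl, -⟩
    by_cases h4 : size l ≤ 3
    · exact Or.inl h4
    · refine Or.inr fun i hi => ?_
      cases hli : l.testBit i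
      · exact Or.inl rfl
      · obtain ⟨c, h1, h2, h3, h5⟩ := h l hl (by omega) i hi hli
        exact Or.inr ⟨c, ⟨h1, h2⟩, by simpa [← Bool.not_eq_true] using h3, h5⟩

theorem pairing_of {T : ℕ → Prop} (hP : Pairing T) {L : List ℕ} (hL : ∀ b, T b ↔ b ∈ L) :
    pairing L = true := by
  simp only [pairing, List.all_eq_true, List.mem_filter, List.mem_range, Nat.beq_eq,
    List.any_eq_true, Bool.and_eq_true, Nat.ble_eq]
  rintro A ⟨hA, hA4⟩
  obtain ⟨b, hb, h2, h⟩ := hP A hA hA4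
  exact ⟨b, (hL b).1 hb, h2, h⟩

theorem leaf_sound {T : ℕ → Prop} (hT : IsTraceFamily T) (hP : Pairing T) {cur : List ℕ}
    (hcur : ∀ b, b ∈ cur ↔ T b ∧ 3 ≤ size b) (h : leaf cur = true) :
    DoublyRich T ↔ Covers T := by
  have hL := mem_traces_iff hT hcur
  rw [← covers_iff hL hT.lt, ← doublyRich_iff hcur]
  have hp := pairing_of hP hL
  unfold leaf at h
  split_ifs at h with hd
  · simp only [hp, Bool.not_true, Bool.false_or] at h
    simp [hd, h]
  · simp only [Bool.not_eq_true'] at h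
    simp [hd, h]

theorem testBit_contacts (p : ℕ) (cur : List ℕ) (i : ℕ) :
    (contacts p cur).testBit i ↔ ∃ c ∈ cur, c.testBit p ∧ c.testBit i ∧ (15).testBit i := by
  induction cur with
  | nil => simp [contacts]
  | cons c cur ih =>
    simp only [contacts, List.foldr_cons, Nat.testBit_or, Bool.or_eq_true, List.mem_cons,
      exists_eq_or_imp] at ih ⊢
    rw [ih]
    cases c.testBit p <;> simp

theorem contacts_lt (p : ℕ) (cur : List ℕ) : contacts p cur < 16 := by
  induction cur with
  | nil => simp [contacts]
  | cons c cur ih =>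
    refine Nat.or_lt_two_pow (n := 4) ?_ ih
    cases c.testBit p
    · simp
    · exact lt_of_le_of_lt Nat.and_le_right (by norm_num)

/-- A block that is next in descending order, all larger blocks being in `cur`, is admissible. -/
theorem admissible_of {T : ℕ → Prop} (hT : IsTraceFamily T) {cur : List ℕ} {b : ℕ}
    (hcur : ∀ c ∈ cur, T c ∧ 3 ≤ size c) (hb : T b) (hb3 : 3 ≤ size b) (hbcur : b ∉ cur)
    (hb1 : atMostOne (b &&& 15) = true) (habove : ∀ c, T c → 3 ≤ size c → b < c → c ∈ cur) :
    admissible b cur = true := by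
  have hb5 := hT.lt b hb
  have hcol : ∀ x < 16, atMostOne x = true → x = 0 ∨ x = 8 ∨ (x = 1 ∨ x = 2 ∨ x = 4) := by
    decide
  simp only [admissible, Bool.and_eq_true, Bool.or_eq_true, List.all_eq_true, List.any_eq_true,
    beq_iff_eq, Nat.ble_eq, Nat.blt_eq]
  refine ⟨⟨fun c hc => ?_, ?_⟩, fun p hp => ?_⟩
  · rw [atMostOne_iff (and_lt hb5 c)]
    by_contra h
    exact hbcur (hT.unique b c hb (hcur c hc).1 (by omega) ▸ hc)
  · rcases hcol _ (lt_of_le_of_lt Nat.and_le_right (by norm_num)) hb1 with h | h | h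
    · exact Or.inl (Or.inl h)
    · exact Or.inl (Or.inr h)
    · obtain ⟨c, hc, hc3, hcc, hbc⟩ := hT.sorted b hb hb3 h
      exact Or.inr ⟨c, habove c hc hc3 hbc, hcc, hbc⟩
  · have hp' : 4 ≤ p ∧ p < 9 := by
      simp only [List.mem_cons, List.not_mem_nil, or_false] at hp
      omega
    refine hT.contact p hp'.1 hp'.2 _ (contacts_lt p _) fun i hi => ?_
    obtain ⟨c, hc, h1, h2, -⟩ := (testBit_contacts p _ i).1 hi
    rcases List.mem_cons.1 hc with rfl | hc
    · exact ⟨c, hb, hb3, h1, h2⟩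
    · exact ⟨c, (hcur c hc).1, (hcur c hc).2, h1, h2⟩

/-- The search proves the equivalence for every trace family whose blocks are among those already
chosen and those still to be decided. The list of undecided blocks is descending, so that a block
larger than its head is already decided. -/
theorem search_sound {T : ℕ → Prop} (hT : IsTraceFamily T) (hP : Pairing T) :
    ∀ rest cur : List ℕ, (∀ c ∈ cur, T c ∧ 3 ≤ size c) →
      (∀ b, T b → 3 ≤ size b → b ∈ cur ∨ b ∈ rest) →
      (∀ b ∈ rest, atMostOne (b &&& 15) = true) → rest.Pairwise (· > ·) →
      search leaf rest cur = true → (DoublyRich T ↔ Covers T)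
  | [], cur, hcur, hall, _, _, h =>
    leaf_sound hT hP
      (fun b => ⟨fun hb => hcur b hb, fun hb => by simpa using hall b hb.1 hb.2⟩) h
  | b :: rest, cur, hcur, hall, hone, hdesc, h => by
    have hone' : ∀ c ∈ rest, atMostOne (c &&& 15) = true := fun c hc => hone c (by simp [hc])
    have hdesc' := List.pairwise_cons.1 hdesc
    simp only [search, Bool.and_eq_true, Bool.or_eq_true, Bool.not_eq_true'] at h
    by_cases hb : (T b ∧ 3 ≤ size b) ∧ b ∉ cur
    · have hadm : admissible b cur = true := by
        refine admissible_of hT hcur hb.1.1 hb.1.2 hb.2 (hone b (by simp)) fun c hc hc3 hbc => ?_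
        rcases hall c hc hc3 with h | h
        · exact h
        · rcases List.mem_cons.1 h with rfl | h
          · omega
          · have := hdesc'.1 c h
            omega
      refine search_sound hT hP rest (b :: cur) ?_ ?_ hone' hdesc'.2
        (h.2.resolve_left (by simp [hadm]))
      · intro c hc
        rcases List.mem_cons.1 hc with rfl | hc
        · exact hb.1
        · exact hcur c hc
      · intro c hc hc3
        rcases hall c hc hc3 with h | h
        · exact Or.inl (by simp [h])
        · rcases List.mem_cons.1 h with rfl | h
          · exact Or.inl (by simp)
          · exact Or.inr h
    · refine search_sound hT hP rest cur hcur (fun c hc hc3 => ?_) hone' hdesc'.2 h.1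
      rcases hall c hc hc3 with h | h
      · exact Or.inl h
      · rcases List.mem_cons.1 h with rfl | h
        · exact Or.inl (not_not.1 fun h' => hb ⟨⟨hc, hc3⟩, h'⟩)
        · exact Or.inr h

/-- For trace families satisfying (A1), condition (A2) is equivalent to shattering. -/
theorem doublyRich_iff_covers {T : ℕ → Prop} (hT : IsTraceFamily T) (hP : Pairing T) :
    DoublyRich T ↔ Covers T := by
  have hbase : ∀ b < 512, atMostOne (b &&& 15) = false → 2 ≤ size (b &&& 15) := by decide +kernel
  have htop : ∀ b < 512, ∀ c < 512, 448 ≤ b → 448 ≤ c → 2 ≤ size (b &&& c) := by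
    have : ∀ x < 64, ∀ y < 64, 2 ≤ size ((448 + x) &&& (448 + y)) := by decide +kernel
    intro b hb c hc hb' hc'
    have := this (b - 448) (by omega) (c - 448) (by omega)
    rwa [Nat.add_sub_cancel' hb', Nat.add_sub_cancel' hc'] at this
  have hmem : ∀ m < 512, 448 ≤ m ∧ atMostOne (m &&& 15) = true ∧ size m ≤ 4 →
      m ∈ [448, 449, 450, 452, 456, 464, 480] ∧ 3 ≤ size m := by
    decide +kernel
  have hone : ∀ b, T b → b ≠ 15 → atMostOne (b &&& 15) = true := by
    intro b hb hne
    by_contra h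
    exact hne (hT.unique b 15 hb hT.base (hbase b (hT.lt b hb) (by simpa using h)))
  obtain ⟨m, hm, hm448⟩ := hT.second
  have hm15 : m ≠ 15 := by omega
  obtain ⟨hmL, hm3⟩ := hmem m (hT.lt m hm) ⟨hm448, hone m hm hm15, hT.le_four m hm⟩
  have hs := List.all_eq_true.1 search_leaf m hmL
  have hhigh : ∀ c, T c → 448 ≤ c → c = m := fun c hc h =>
    hT.unique c m hc hm (htop c (hT.lt c hc) m (hT.lt m hm) h hm448)
  have h15 : ∀ c ∈ [15], T c ∧ 3 ≤ size c := by
    intro c hc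
    rw [List.mem_singleton.1 hc]
    exact ⟨hT.base, by decide⟩
  have hadm : admissible m [15] = true := by
    refine admissible_of hT h15 hm hm3 (by simpa using hm15) (hone m hm hm15) ?_
    intro c hc _ hmc
    have := hhigh c hc (by omega)
    omega
  simp only [hadm, Bool.not_true, Bool.false_or] at hs
  refine search_sound hT hP _ _ ?_ ?_ ?_ ?_ hs
  · intro c hc
    rcases List.mem_cons.1 hc with rfl | hc
    · exact ⟨hm, hm3⟩
    · exact h15 c hc
  · intro b hb hb3
    by_cases h15 : b = 15
    · simp [h15]
    by_cases h448 : 448 ≤ b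
    · simp [hhigh b hb h448]
    · right
      simp only [candidates, List.mem_filter, List.mem_reverse, List.mem_range, Bool.and_eq_true,
        Nat.ble_eq]
      exact ⟨by omega, ⟨hb3, hT.le_four b hb⟩, hone b hb h15⟩
  · intro b hb
    simp only [candidates, List.mem_filter, Bool.and_eq_true] at hb
    exact hb.2.2
  · refine List.Pairwise.filter _ ?_
    rw [List.pairwise_reverse]
    exact List.pairwise_lt_range
end Mask

/-! ### Lines in the plane and the bound of four points on a line -/

theorem span_pair_mem_planeLines {a b : Plane} (h : a ≠ b) :
    (affineSpan ℝ {a, b} : Set Plane) ∈ planeLines := by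
  refine ⟨affineSpan ℝ {a, b}, ?_, rfl⟩
  rw [direction_affineSpan, vectorSpan_pair]
  exact finrank_span_singleton (vsub_ne_zero.2 h)

theorem span_pair_eq {L : Set Plane} (hL : L ∈ planeLines) {a b : Plane} (h : a ≠ b)
    (ha : a ∈ L) (hb : b ∈ L) : (affineSpan ℝ {a, b} : Set Plane) = L := by
  obtain ⟨A, hA, rfl⟩ := hL
  have hle : affineSpan ℝ {a, b} ≤ A := affineSpan_le.2 (by
    rintro x (rfl | rfl)
    · exact ha
    · exact hb)
  have hfin : Module.finrank ℝ (affineSpan ℝ {a, b}).direction = 1 := by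
    rw [direction_affineSpan, vectorSpan_pair]
    exact finrank_span_singleton (vsub_ne_zero.2 h)
  have hdir : (affineSpan ℝ {a, b}).direction = A.direction :=
    Submodule.eq_of_le_of_finrank_eq (AffineSubspace.direction_le hle) (hfin.trans hA.symm)
  rw [AffineSubspace.eq_of_direction_eq_of_nonempty_of_le hdir
    ⟨a, left_mem_affineSpan_pair ℝ a b⟩ hle]

theorem line_eq {L M : Set Plane} (hL : L ∈ planeLines) (hM : M ∈ planeLines) {a b : Plane}
    (h : a ≠ b) (haL : a ∈ L) (hbL : b ∈ L) (haM : a ∈ M) (hbM : b ∈ M) : L = M :=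
  (span_pair_eq hL h haL hbL).symm.trans (span_pair_eq hM h haM hbM)

/-- Some line through `p` contains no other point of a finite set: choose a slope different from those
of the lines joining `p` to the points of the set. -/
theorem exists_line_through_avoiding (p : Plane) {F : Set Plane} (hF : F.Finite) :
    ∃ L ∈ planeLines, p ∈ L ∧ ∀ q ∈ F, q ∈ L → q = p := by
  obtain ⟨t, ht⟩ := (hF.image fun q : Plane => (q 1 - p 1) / (q 0 - p 0)).exists_notMem
  have hv : (!₂[1, t] : Plane) ≠ 0 := fun h => by
    simpa using congrArg (fun v : Plane => v 0) h
  have hne : p ≠ (!₂[1, t] : Plane) +ᵥ p := fun h => hv (by simpa using h.symm)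
  refine ⟨_, span_pair_mem_planeLines hne, left_mem_affineSpan_pair ℝ _ _, fun q hq hqL => ?_⟩
  obtain ⟨s, rfl⟩ := mem_affineSpan_pair_iff_exists_lineMap_eq.1 hqL
  by_contra hqp
  refine ht ⟨_, hq, ?_⟩
  have hs : s ≠ 0 := fun h => hqp (by simp [h])
  simp [AffineMap.lineMap_apply, hs]

theorem exists_line_disjoint {F : Set Plane} (hF : F.Finite) :
    ∃ L ∈ planeLines, ∀ q ∈ F, q ∉ L := by
  obtain ⟨p, hp⟩ := hF.exists_notMem
  obtain ⟨L, hL, -, h⟩ := exists_line_through_avoiding p hF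
  exact ⟨L, hL, fun q hq hqL => hp (h q hq hqL ▸ hq)⟩

theorem exists_line_mem_mem {a b : Plane} (h : a ≠ b) : ∃ L ∈ planeLines, a ∈ L ∧ b ∈ L :=
  ⟨_, span_pair_mem_planeLines h, left_mem_affineSpan_pair ℝ _ _,
    right_mem_affineSpan_pair ℝ _ _⟩

theorem exists_line_of_collinear {P Q : Set Plane} (hP : P.Finite) (hQP : Q ⊆ P)
    (hQ : Q.ncard = 4) (hcol : Collinear ℝ Q) : ∃ l ∈ planeLines, 4 ≤ (l ∩ P).ncard := by
  have hQfin : Q.Finite := hP.subset hQP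
  obtain ⟨a, ha, b, hb, hab⟩ := (Set.one_lt_ncard hQfin).1 (by omega)
  refine ⟨_, span_pair_mem_planeLines hab, ?_⟩
  rw [← hQ]
  exact Set.ncard_le_ncard
    (fun q hq => ⟨hcol.mem_affineSpan_of_mem_of_ne ha hb hq hab, hQP hq⟩)
    (hP.subset Set.inter_subset_right)

theorem condO_of_shatters {P : Set Plane} (h : FamilyShatters (lineUnions 3) P) : CondO P := by
  classical
  obtain ⟨_, ⟨f, hf, rfl⟩, hP⟩ := h P subset_rfl
  refine ⟨Finset.univ.image f, by simpa using hf, Finset.card_image_le, fun p hp => ?_⟩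
  rw [← hP] at hp
  obtain ⟨i, hi⟩ := Set.mem_iUnion.1 hp.1
  exact ⟨f i, by simp, hi⟩

/-- Pigeonhole for three lines covering more than three points. -/
theorem exists_pair_on_line {f : Fin 3 → Set Plane} {A : Set Plane} (hA : 3 < A.ncard)
    (h : A ⊆ ⋃ i, f i) : ∃ i, ∃ a ∈ A, ∃ b ∈ A, a ≠ b ∧ a ∈ f i ∧ b ∈ f i := by
  have hfin : A.Finite := Set.finite_of_ncard_pos (by omega)
  choose! g hg using fun (a : Plane) (ha : a ∈ A) => Set.mem_iUnion.1 (h ha)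
  rw [Set.ncard_eq_toFinset_card A hfin] at hA
  obtain ⟨a, ha, b, hb, hab, he⟩ := Finset.exists_ne_map_eq_of_card_lt_of_maps_to
    (s := hfin.toFinset) (t := Finset.univ) (f := g) (by simpa using hA) (by simp)
  rw [Set.Finite.mem_toFinset] at ha hb
  exact ⟨g a, a, ha, b, hb, hab, hg a ha, he ▸ hg b hb⟩

theorem condA1_of_shatters {P : Set Plane} (h : FamilyShatters (lineUnions 3) P) : CondA1 P := by
  intro A hAP hA
  obtain ⟨_, ⟨f, hf, rfl⟩, hfA⟩ := h A hAP
  obtain ⟨i, a, ha, b, hb, hab, hai, hbi⟩ := exists_pair_on_line (f := f) (A := A) (by omega)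
    (fun x hx => (hfA ▸ hx : x ∈ (⋃ i, f i) ∩ P).1)
  refine ⟨a, ha, b, hb, hab, ?_⟩
  rw [PairInside, span_pair_eq (hf i) hab hai hbi, ← hfA]
  exact Set.inter_subset_inter_left _ (Set.subset_iUnion f i)

/-- If a line `l` had five points of `P`, then `P` without one point `x ∈ l` could not be isolated: two
of the remaining points of `l` would lie on one of the three lines, which would then be `l` and
contain `x`. -/
theorem ncard_inter_le_four_of_shatters {P : Set Plane} (hP : P.Finite)
    (h : FamilyShatters (lineUnions 3) P) {l : Set Plane} (hl : l ∈ planeLines) :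
    (l ∩ P).ncard ≤ 4 := by
  by_contra! h5
  obtain ⟨x, hx⟩ : (l ∩ P).Nonempty := Set.nonempty_of_ncard_ne_zero (by omega)
  have hfin : (l ∩ P).Finite := hP.subset Set.inter_subset_right
  obtain ⟨_, ⟨f, hf, rfl⟩, hfP⟩ := h (P \ {x}) Set.sdiff_subset
  have h4 : 3 < ((l ∩ P) \ {x}).ncard := by
    rw [Set.ncard_sdiff_singleton_of_mem hx]
    omega
  obtain ⟨i, a, ha, b, hb, hab, hai, hbi⟩ := exists_pair_on_line (f := f) h4
    (fun p hp => (hfP ▸ ⟨hp.1.2, hp.2⟩ : p ∈ (⋃ i, f i) ∩ P).1)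
  have hfl := line_eq (hf i) hl hab hai hbi ha.1.1 hb.1.1
  have : x ∈ P \ {x} := hfP ▸ ⟨Set.mem_iUnion.2 ⟨i, hfl ▸ hx.1⟩, hx.2⟩
  exact this.2 rfl

/-- By (A1), a point `p` off a line `l` with four points of `P` cannot be joined by lines with three
points of `P` to three points `x, y, z` of `l`: no two of the points `p, x, y, z` pair inside
`{p, x, y, z}`. -/
theorem no_three_rich_joins {P l : Set Plane} (hA1 : CondA1 P)
    (hl : l ∈ planeLines) {p x y z w : Plane} (hp : p ∈ P) (hpl : p ∉ l)
    (hx : x ∈ l ∩ P) (hy : y ∈ l ∩ P) (hz : z ∈ l ∩ P) (hw : w ∈ l ∩ P)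
    (hxy : x ≠ y) (hxz : x ≠ z) (hyz : y ≠ z) (hwx : w ≠ x) (hwy : w ≠ y) (hwz : w ≠ z)
    (hrich : ∀ u ∈ ({x, y, z} : Set Plane),
      ∃ L ∈ planeLines, p ∈ L ∧ u ∈ L ∧ 3 ≤ (L ∩ P).ncard) : False := by
  have hsub : ({x, y, z} : Set Plane) ⊆ l ∩ P := by
    rintro u (rfl | rfl | rfl) <;> assumption
  have hpn : p ∉ ({x, y, z} : Set Plane) := fun h => hpl (hsub h).1
  have h3 : ({x, y, z} : Set Plane).ncard = 3 := Set.ncard_eq_three.2 ⟨x, y, z, hxy, hxz, hyz, rfl⟩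
  have h4 : (insert p {x, y, z} : Set Plane).ncard = 4 := by
    rw [Set.ncard_insert_of_notMem hpn (Set.toFinite _), h3]
  obtain ⟨a, ha, b, hb, hab, hin⟩ :=
    hA1 _ (Set.insert_subset hp (hsub.trans Set.inter_subset_right)) h4
  set M : Set Plane := (affineSpan ℝ {a, b} : Set Plane) with hMdef
  have hM : M ∈ planeLines := span_pair_mem_planeLines hab
  have haM : a ∈ M := left_mem_affineSpan_pair ℝ _ _
  have hbM : b ∈ M := right_mem_affineSpan_pair ℝ _ _
  -- a line with two of `x, y, z` is `l`, which contains `w`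
  have htwo : ∀ u ∈ ({x, y, z} : Set Plane), ∀ v ∈ ({x, y, z} : Set Plane), u ∈ M → v ∈ M →
      u = v := by
    intro u hu v hv huM hvM
    by_contra huv
    have hMl := line_eq hM hl huv huM hvM (hsub hu).1 (hsub hv).1
    rcases hin ⟨show w ∈ M from hMl ▸ hw.1, hw.2⟩ with h | h | h | h
    · exact hpl (h ▸ hw.1)
    · exact hwx h
    · exact hwy h
    · exact hwz h
  -- a line through `p` and `u` is rich, so it has a third point among `x, y, z`
  have hone : ∀ u ∈ ({x, y, z} : Set Plane), p ∈ M → u ∈ M → False := by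
    intro u hu hpM huM
    obtain ⟨L, hL, hpL, huL, hL3⟩ := hrich u hu
    have hpu : p ≠ u := fun h => hpn (h ▸ hu)
    rw [line_eq hL hM hpu hpL huL hpM huM] at hL3
    have : M ∩ P ⊆ {p, u} := by
      intro v hv
      rcases hin hv with h | h
      · exact Or.inl h
      · exact Or.inr (htwo v h u hu hv.1 huM)
    have := (Set.ncard_le_ncard this (Set.toFinite _)).trans_eq (Set.ncard_pair hpu)
    omega
  rcases ha with rfl | ha <;> rcases hb with rfl | hb
  · exact hab rfl
  · exact hone b hb haM hbM
  · exact hone a ha hbM haM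
  · exact hab (htwo a ha b hb haM hbM)

/-- Double counting of the incidences between the points of `l` and the points of `P` off `l`, a point
`x ∈ l` being incident with the points on a second rich line through `x` given by (A2). -/
theorem ncard_inter_le_four_of_conds {P : Set Plane} (hcard : P.ncard = 9) (hA1 : CondA1 P)
    (hA2 : CondA2 P) {l : Set Plane} (hl : l ∈ planeLines) : (l ∩ P).ncard ≤ 4 := by
  classical
  by_contra! h5
  have hP : P.Finite := Set.finite_of_ncard_pos (by omega)
  choose! L hL hLl hxL hL3 using hA2 l hl h5.le
  have hS : (l ∩ P).Finite := hP.subset Set.inter_subset_right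
  have hR : (P \ l).Finite := hP.subset Set.sdiff_subset
  have hSc := Set.ncard_eq_toFinset_card _ hS
  have hsum : (l ∩ P).ncard + (P \ l).ncard = 9 := by
    rw [Set.inter_comm, Set.ncard_inter_add_ncard_sdiff_eq_ncard P l hP, hcard]
  -- each `x ∈ l` has at least two incidences, each `p ∉ l` at most two
  have hdc := Finset.card_mul_le_card_mul (s := hS.toFinset) (t := hR.toFinset)
    (m := 2) (n := 2) (fun x p => p ∈ L x) ?_ ?_
  · rw [← hSc, ← Set.ncard_eq_toFinset_card _ hR] at hdc
    omega
  · intro x hx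
    rw [Set.Finite.mem_toFinset] at hx
    have hsub : (L x ∩ P) \ {x} ⊆ ↑(hR.toFinset.bipartiteAbove (fun x p => p ∈ L x) x) := by
      rintro p ⟨⟨hpL, hpP⟩, hpx⟩
      simp only [Finset.bipartiteAbove, Finset.coe_filter, Set.Finite.mem_toFinset]
      refine ⟨⟨hpP, fun hpl => hLl x hx ?_⟩, hpL⟩
      exact line_eq (hL x hx) hl (fun h => hpx h) hpL (hxL x hx) hpl hx.1
    have h1 := Set.ncard_le_ncard hsub (Finset.finite_toSet _)
    rw [Set.ncard_coe_finset, Set.ncard_sdiff_singleton_of_mem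
      (show x ∈ L x ∩ P from ⟨hxL x hx, hx.2⟩)] at h1
    have := hL3 x hx
    omega
  · intro p hp
    rw [Set.Finite.mem_toFinset] at hp
    by_contra! h3
    obtain ⟨x, hx, y, hy, z, hz, hxy, hxz, hyz⟩ := Finset.two_lt_card.1 h3
    simp only [Finset.bipartiteBelow, Finset.mem_filter, Set.Finite.mem_toFinset] at hx hy hz
    obtain ⟨w, hw, hwn⟩ := Finset.exists_mem_notMem_of_card_lt_card
      (s := {x, y, z}) (t := hS.toFinset) (lt_of_le_of_lt Finset.card_le_three (by omega))
    simp only [Finset.mem_insert, Finset.mem_singleton, not_or] at hwn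
    refine no_three_rich_joins hA1 hl hp.1 hp.2 hx.1 hy.1 hz.1 (hS.mem_toFinset.1 hw) hxy hxz hyz
      hwn.1 hwn.2.1 hwn.2.2 ?_
    rintro u (rfl | rfl | rfl)
    · exact ⟨_, hL _ hx.1, hx.2, hxL _ hx.1, hL3 _ hx.1⟩
    · exact ⟨_, hL _ hy.1, hy.2, hxL _ hy.1, hL3 _ hy.1⟩
    · exact ⟨_, hL _ hz.1, hz.2, hxL _ hz.1, hL3 _ hz.1⟩

/-- One of the lines in (O) is `l`, since other lines meet `l` in at most one point. The five points off
`l` lie on the at most two others. -/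
theorem exists_second_line {P l : Set Plane} (hcard : P.ncard = 9) (hO : CondO P)
    (hl : l ∈ planeLines) (h4 : (l ∩ P).ncard = 4) :
    ∃ m ∈ planeLines, 3 ≤ (m ∩ (P \ l)).ncard := by
  classical
  have hP : P.Finite := Set.finite_of_ncard_pos (by omega)
  have hS : (l ∩ P).Finite := hP.subset Set.inter_subset_right
  have hR : (P \ l).Finite := hP.subset Set.sdiff_subset
  have hsum : (l ∩ P).ncard + (P \ l).ncard = 9 := by
    rw [Set.inter_comm, Set.ncard_inter_add_ncard_sdiff_eq_ncard P l hP, hcard]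
  obtain ⟨C, hC, hC3, hcov⟩ := hO
  choose! g hg using hcov
  have hlC : l ∈ C := by
    by_contra hlC
    rw [Set.ncard_eq_toFinset_card _ hS] at h4
    obtain ⟨a, ha, b, hb, hab, he⟩ := Finset.exists_ne_map_eq_of_card_lt_of_maps_to
      (s := hS.toFinset) (t := C) (f := g) (by omega)
      (fun a ha => (hg a (hS.mem_toFinset.1 ha).2).1)
    rw [Set.Finite.mem_toFinset] at ha hb
    have := line_eq (hC _ (hg a ha.2).1) hl hab (hg a ha.2).2 (he ▸ (hg b hb.2).2) ha.1 hb.1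
    exact hlC (this ▸ (hg a ha.2).1)
  have hRc := Set.ncard_eq_toFinset_card _ hR
  obtain ⟨m, hm, hm2⟩ := Finset.exists_lt_card_fiber_of_mul_lt_card_of_maps_to
    (s := hR.toFinset) (t := C.erase l) (f := g) (n := 2)
    (fun a ha => by
      rw [Set.Finite.mem_toFinset] at ha
      exact Finset.mem_erase.2 ⟨fun h => ha.2 (h ▸ (hg a ha.1).2), (hg a ha.1).1⟩)
    (by rw [Finset.card_erase_of_mem hlC]; omega)
  refine ⟨m, hC m (Finset.mem_of_mem_erase hm), hm2.trans_le ?_⟩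
  rw [← Set.ncard_coe_finset]
  refine Set.ncard_le_ncard (fun a ha => ?_) (hR.subset Set.inter_subset_right)
  simp only [Finset.coe_filter, Set.Finite.mem_toFinset] at ha
  exact ⟨ha.2 ▸ (hg a ha.1.1).2, ha.1⟩

/-! ### The traces of lines on nine labelled points -/

namespace Mask

open Classical in
/-- The mask of the set of labels `i` with `e i ∈ s`. -/
noncomputable def maskOf (e : Fin 9 → Plane) (s : Set Plane) : ℕ :=
  Nat.ofBits fun i => decide (e i ∈ s)

/-- The masks of the lines in the plane. -/
def LineTrace (e : Fin 9 → Plane) (b : ℕ) : Prop := ∃ L ∈ planeLines, maskOf e L = b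

section
variable {e : Fin 9 → Plane}

theorem maskOf_lt (s : Set Plane) : maskOf e s < 512 := Nat.ofBits_lt_two_pow (n := 9) _

theorem testBit_maskOf (s : Set Plane) (j : ℕ) :
    (maskOf e s).testBit j ↔ ∃ h : j < 9, e ⟨j, h⟩ ∈ s := by
  classical
  rw [maskOf, Nat.testBit_ofBits]
  split_ifs with h <;> simp [h]

theorem testBit_maskOf_fin (s : Set Plane) (i : Fin 9) :
    (maskOf e s).testBit i ↔ e i ∈ s := by
  rw [testBit_maskOf]
  exact ⟨fun ⟨_, h⟩ => h, fun h => ⟨i.2, h⟩⟩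

theorem maskOf_inter (s t : Set Plane) : maskOf e (s ∩ t) = maskOf e s &&& maskOf e t := by
  refine Nat.eq_of_testBit_eq fun j => Bool.eq_iff_iff.2 ?_
  rw [Nat.testBit_and, Bool.and_eq_true, testBit_maskOf, testBit_maskOf, testBit_maskOf]
  exact ⟨fun ⟨h, h1, h2⟩ => ⟨⟨h, h1⟩, h, h2⟩, fun ⟨⟨h, h1⟩, _, h2⟩ => ⟨h, h1, h2⟩⟩

theorem maskOf_union (s t : Set Plane) : maskOf e (s ∪ t) = maskOf e s ||| maskOf e t := by
  refine Nat.eq_of_testBit_eq fun j => Bool.eq_iff_iff.2 ?_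
  rw [Nat.testBit_or, Bool.or_eq_true, testBit_maskOf, testBit_maskOf, testBit_maskOf]
  constructor
  · rintro ⟨h, h1 | h1⟩
    exacts [Or.inl ⟨h, h1⟩, Or.inr ⟨h, h1⟩]
  · rintro (⟨h, h1⟩ | ⟨h, h1⟩)
    exacts [⟨h, Or.inl h1⟩, ⟨h, Or.inr h1⟩]

theorem maskOf_eq_iff {s t : Set Plane} :
    maskOf e s = maskOf e t ↔ s ∩ Set.range e = t ∩ Set.range e := by
  constructor
  · intro h
    have : ∀ i, e i ∈ s ↔ e i ∈ t := fun i => by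
      rw [← testBit_maskOf_fin, ← testBit_maskOf_fin, h]
    ext p
    constructor
    · rintro ⟨hp, i, rfl⟩
      exact ⟨(this i).1 hp, i, rfl⟩
    · rintro ⟨hp, i, rfl⟩
      exact ⟨(this i).2 hp, i, rfl⟩
  · intro h
    have : ∀ i, e i ∈ s ↔ e i ∈ t := fun i => by simpa using Set.ext_iff.1 h (e i)
    refine Nat.eq_of_testBit_eq fun j => Bool.eq_iff_iff.2 ?_
    simp only [testBit_maskOf, this]

theorem exists_maskOf_eq (he : e.Injective) {b : ℕ} (hb : b < 512) :
    ∃ Z ⊆ Set.range e, maskOf e Z = b := by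
  refine ⟨e '' {i | b.testBit i}, Set.image_subset_range _ _, ?_⟩
  refine Nat.eq_of_testBit_eq fun j => Bool.eq_iff_iff.2 ?_
  simp only [testBit_maskOf, he.mem_set_image, Set.mem_ofPred_eq, exists_prop, and_iff_right_iff_imp]
  intro h
  by_contra hj
  have h9 : 2 ^ 9 ≤ 2 ^ j := Nat.pow_le_pow_right two_pos (not_lt.1 hj)
  have := Nat.testBit_lt_two_pow (lt_of_lt_of_le hb h9)
  simp [this] at h

theorem size_maskOf (he : e.Injective) (s : Set Plane) :
    size (maskOf e s) = (s ∩ Set.range e).ncard := by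
  classical
  have hsize : ∀ b < 512, size b = (Finset.univ.filter fun i : Fin 9 => b.testBit i).card := by
    decide +kernel
  have hs : s ∩ Set.range e = e '' {i | e i ∈ s} := by
    ext p
    constructor
    · rintro ⟨hp, i, rfl⟩
      exact ⟨i, hp, rfl⟩
    · rintro ⟨i, hi, rfl⟩
      exact ⟨hi, i, rfl⟩
  rw [hsize _ (maskOf_lt s), hs, Set.ncard_image_of_injective _ he, ← Set.ncard_coe_finset]
  congr 1
  ext i
  simp [testBit_maskOf_fin]

theorem and_maskOf_eq_iff {s t : Set Plane} :
    maskOf e s &&& maskOf e t = maskOf e s ↔ s ∩ Set.range e ⊆ t := by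
  rw [← maskOf_inter, maskOf_eq_iff]
  constructor
  · intro h p hp
    rw [← h] at hp
    exact hp.1.2
  · intro h
    ext p
    exact ⟨fun hp => ⟨hp.1.1, hp.2⟩, fun hp => ⟨⟨hp.1, h hp⟩, hp.2⟩⟩

/-- Two lines whose masks share two points are equal. -/
theorem line_eq_of_size (he : e.Injective) {L M : Set Plane} (hL : L ∈ planeLines)
    (hM : M ∈ planeLines) (h : 2 ≤ size (maskOf e L &&& maskOf e M)) : L = M := by
  rw [← maskOf_inter, size_maskOf he] at h
  obtain ⟨a, ha, b, hb, hab⟩ :=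
    (Set.one_lt_ncard (Set.finite_of_ncard_pos (by omega))).1 (show 1 < _ from h)
  exact line_eq hL hM hab ha.1.1 hb.1.1 ha.1.2 hb.1.2

theorem lineTrace_small (he : e.Injective) {b : ℕ} (hb : b < 512) (h1 : size b ≤ 1) :
    LineTrace e b := by
  obtain ⟨Z, hZ, rfl⟩ := exists_maskOf_eq he hb
  have hfin : (Set.range e).Finite := Set.finite_range e
  rw [size_maskOf he, Set.inter_eq_left.2 hZ, Set.ncard_le_one (hfin.subset hZ)] at h1
  rcases Z.eq_empty_or_nonempty with rfl | ⟨p, hp⟩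
  · obtain ⟨L, hL, h⟩ := exists_line_disjoint hfin
    refine ⟨L, hL, maskOf_eq_iff.2 ?_⟩
    ext q
    exact ⟨fun hq => (h q hq.2 hq.1).elim, fun hq => hq.1.elim⟩
  · obtain ⟨L, hL, hpL, h⟩ := exists_line_through_avoiding p hfin
    refine ⟨L, hL, maskOf_eq_iff.2 ?_⟩
    ext q
    refine and_congr_left fun hq => ⟨fun hqL => h q hq hqL ▸ hp, fun hqZ => ?_⟩
    rwa [h1 q hqZ p hp]

theorem lineTrace_join (he : e.Injective) {b : ℕ} (hb : b < 512) (h2 : size b = 2) :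
    ∃ c, LineTrace e c ∧ b &&& c = b := by
  obtain ⟨Z, hZ, rfl⟩ := exists_maskOf_eq he hb
  rw [size_maskOf he, Set.inter_eq_left.2 hZ, Set.ncard_eq_two] at h2
  obtain ⟨x, y, hxy, rfl⟩ := h2
  obtain ⟨L, hL, hx, hy⟩ := exists_line_mem_mem hxy
  refine ⟨_, ⟨L, hL, rfl⟩, and_maskOf_eq_iff.2 ?_⟩
  rintro p ⟨rfl | rfl, -⟩
  exacts [hx, hy]

theorem pairing_lineTrace (he : e.Injective) (hA1 : CondA1 (Set.range e)) :
    Pairing (LineTrace e) := by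
  intro A hA hA4
  obtain ⟨Z, hZ, rfl⟩ := exists_maskOf_eq he hA
  rw [size_maskOf he, Set.inter_eq_left.2 hZ] at hA4
  obtain ⟨a, ha, b, hb, hab, hin⟩ := hA1 Z hZ hA4
  refine ⟨_, ⟨_, span_pair_mem_planeLines hab, rfl⟩, ?_, and_maskOf_eq_iff.2 hin⟩
  rw [size_maskOf he]
  refine (Set.ncard_pair hab).ge.trans (Set.ncard_le_ncard ?_ ?_)
  swap
  · exact (Set.finite_range e).subset Set.inter_subset_right
  rintro p (rfl | rfl)
  exacts [⟨left_mem_affineSpan_pair ℝ _ _, hZ ha⟩, ⟨right_mem_affineSpan_pair ℝ _ _, hZ hb⟩]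

theorem doublyRich_lineTrace_iff (he : e.Injective) :
    DoublyRich (LineTrace e) ↔ CondA2 (Set.range e) := by
  constructor
  · rintro h l hl h4 x ⟨hxl, i, rfl⟩
    rw [← size_maskOf he] at h4
    obtain ⟨_, ⟨L, hL, rfl⟩, h3, hne, hi⟩ :=
      h _ ⟨l, hl, rfl⟩ h4 i i.2 ((testBit_maskOf_fin l i).2 hxl)
    rw [size_maskOf he] at h3
    exact ⟨L, hL, fun h => hne (h ▸ rfl), (testBit_maskOf_fin L i).1 hi, h3⟩
  · rintro h _ ⟨l, hl, rfl⟩ h4 i hi hil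
    have h4' := h4
    rw [size_maskOf he] at h4'
    obtain ⟨hi, hil⟩ := (testBit_maskOf l i).1 hil
    obtain ⟨L, hL, hne, hx, h3⟩ := h l hl h4' (e ⟨i, hi⟩) ⟨hil, _, rfl⟩
    rw [← size_maskOf he] at h3
    refine ⟨_, ⟨L, hL, rfl⟩, h3, fun heq => hne ?_, (testBit_maskOf L i).2 ⟨hi, hx⟩⟩
    refine line_eq_of_size he hL hl ?_
    rw [heq, Nat.and_self]
    omega

theorem covers_lineTrace_iff (he : e.Injective) :
    Covers (LineTrace e) ↔ FamilyShatters (lineUnions 3) (Set.range e) := by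
  have hU : ∀ f : Fin 3 → Set Plane, (⋃ i, f i) = f 0 ∪ (f 1 ∪ f 2) := by
    intro f
    ext p
    simp [Fin.exists_fin_succ]
  constructor
  · intro h Z hZ
    obtain ⟨_, _, _, ⟨L, hL, rfl⟩, ⟨M, hM, rfl⟩, ⟨N, hN, rfl⟩, hLMN⟩ := h _ (maskOf_lt (e := e) Z)
    rw [← maskOf_union, ← maskOf_union, maskOf_eq_iff, Set.inter_eq_left.2 hZ] at hLMN
    refine ⟨_, ⟨![L, M, N], ?_, rfl⟩, ?_⟩
    · intro i
      fin_cases i <;> assumption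
    · rw [hU]
      exact hLMN
  · intro h Z hZ
    obtain ⟨Z, hZe, rfl⟩ := exists_maskOf_eq he hZ
    obtain ⟨_, ⟨f, hf, rfl⟩, hfZ⟩ := h Z hZe
    refine ⟨_, _, _, ⟨f 0, hf 0, rfl⟩, ⟨f 1, hf 1, rfl⟩, ⟨f 2, hf 2, rfl⟩, ?_⟩
    rw [← maskOf_union, ← maskOf_union, maskOf_eq_iff, ← hU, hfZ, Set.inter_eq_left.2 hZe]

/-- The largest value of `maskOf e L / 16`, the mask of the points of `L` with labels from `4` on, over
the lines `L ≠ l` through `p` with at least three labelled points; it is `0` if there is none. The labels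
on `l` are sorted by this number. -/
noncomputable def colourKey (e : Fin 9 → Plane) (l : Set Plane) (p : Plane) : ℕ :=
  sSup {n | ∃ L ∈ planeLines, L ≠ l ∧ p ∈ L ∧ 3 ≤ (L ∩ Set.range e).ncard ∧ n = maskOf e L / 16}

theorem maskOf_mod (L : Set Plane) : maskOf e L &&& 15 = maskOf e L % 16 :=
  Nat.and_two_pow_sub_one_eq_mod _ 4

/-- For a labelling in which `l` carries the labels `0, 1, 2, 3`, sorted by `colourKey`, and `m` carries
`6, 7, 8`, the masks of lines have all properties that the search uses. -/
theorem isTraceFamily_lineTrace (he : e.Injective) {l m : Set Plane}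
    (hl : l ∈ planeLines) (hm : m ∈ planeLines) (hel : ∀ i, e i ∈ l ↔ i.1 < 4)
    (hem : ∀ i : Fin 9, 6 ≤ i.1 → e i ∈ m)
    (hle : ∀ L ∈ planeLines, (L ∩ Set.range e).ncard ≤ 4) (hA1 : CondA1 (Set.range e))
    (hkey : ∀ i j : Fin 9, i ≤ j → j.1 < 4 → colourKey e l (e i) ≤ colourKey e l (e j)) :
    IsTraceFamily (LineTrace e) := by
  have hlmask : maskOf e l = 15 := by
    refine Nat.eq_of_testBit_eq fun j => Bool.eq_iff_iff.2 ?_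
    rw [testBit_maskOf, show 15 = 2 ^ 4 - 1 from rfl, Nat.testBit_two_pow_sub_one,
      decide_eq_true_eq]
    exact ⟨fun ⟨h, h1⟩ => (hel _).1 h1, fun h => ⟨by omega, (hel _).2 h⟩⟩
  -- a line other than `l` has at most one point on `l`
  have hcolour : ∀ L ∈ planeLines, L ≠ l → ∀ i : ℕ, i < 4 → (maskOf e L).testBit i →
      maskOf e L &&& 15 = 2 ^ i := by
    intro L hL hne i hi hiL
    have hone : ∀ x < 16, ∀ i < 4, x.testBit i = true → size x ≤ 1 → x = 2 ^ i := by decide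
    refine hone _ (lt_of_le_of_lt Nat.and_le_right (by norm_num)) i hi ?_ ?_
    · rw [Nat.testBit_and, hiL, show 15 = 2 ^ 4 - 1 from rfl, Nat.testBit_two_pow_sub_one]
      simpa using hi
    · by_contra h
      exact hne (line_eq_of_size he hL hl (by rw [hlmask]; omega))
  refine
    { lt := ?_, small := fun b => lineTrace_small he, join := fun b => lineTrace_join he,
      unique := ?_, base := ⟨l, hl, hlmask⟩, le_four := ?_, second := ⟨_, ⟨m, hm, rfl⟩, ?_⟩,
      sorted := ?_, contact := ?_ }
  · rintro _ ⟨L, -, rfl⟩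
    exact maskOf_lt L
  · rintro _ _ ⟨L, hL, rfl⟩ ⟨M, hM, rfl⟩ h
    rw [line_eq_of_size he hL hM h]
  · rintro _ ⟨L, hL, rfl⟩
    rw [size_maskOf he]
    exact hle L hL
  · have htop : ∀ b < 512, b.testBit 6 = true ∧ b.testBit 7 = true ∧ b.testBit 8 = true →
        448 ≤ b := by decide +kernel
    exact htop _ (maskOf_lt m) ⟨(testBit_maskOf_fin m 6).2 (hem 6 (by decide)),
      (testBit_maskOf_fin m 7).2 (hem 7 (by decide)),
      (testBit_maskOf_fin m 8).2 (hem 8 (by decide))⟩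
  · rintro _ ⟨L, hL, rfl⟩ h3 hcol
    obtain ⟨i, hi, hcol⟩ : ∃ i < 3, maskOf e L &&& 15 = 2 ^ i := by
      rcases hcol with h | h | h
      exacts [⟨0, by norm_num, h⟩, ⟨1, by norm_num, h⟩, ⟨2, by norm_num, h⟩]
    have hiL : (maskOf e L).testBit i := by
      have : (maskOf e L &&& 15).testBit i := by rw [hcol, Nat.testBit_two_pow_self]
      rw [Nat.testBit_and, Bool.and_eq_true] at this
      exact this.1
    obtain ⟨hi9, hiL'⟩ := (testBit_maskOf L i).1 hiL
    have hLl : L ≠ l := by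
      rintro rfl
      rw [hlmask] at hcol
      interval_cases i <;> exact absurd hcol (by decide)
    have h3' := h3
    rw [size_maskOf he] at h3'
    have hbdd : ∀ p, BddAbove {n | ∃ L ∈ planeLines, L ≠ l ∧ p ∈ L ∧
        3 ≤ (L ∩ Set.range e).ncard ∧ n = maskOf e L / 16} := by
      rintro p
      refine ⟨512, ?_⟩
      rintro _ ⟨M, -, -, -, -, rfl⟩
      exact (Nat.div_le_self _ _).trans (maskOf_lt M).le
    have hle1 : maskOf e L / 16 ≤ colourKey e l (e ⟨i, hi9⟩) :=
      le_csSup (hbdd _) ⟨L, hL, hLl, hiL', h3', rfl⟩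
    have hle2 := hle1.trans (hkey ⟨i, hi9⟩ ⟨i + 1, by omega⟩ (Fin.mk_le_mk.2 (by omega))
      (show i + 1 < 4 by omega))
    -- a block has points off `l`, so the key is positive and hence attained by a block
    have hpos : 0 < maskOf e L / 16 := by
      by_contra h0
      have hs : ∀ i < 3, size (2 ^ i) = 1 := by decide
      rw [maskOf_mod, Nat.mod_eq_of_lt (by omega)] at hcol
      rw [hcol, hs i hi] at h3
      omega
    have hne : colourKey e l (e ⟨i + 1, by omega⟩) ≠ 0 := by omega
    obtain ⟨M, hM, hMl, hiM, hM3, hkM⟩ := Nat.sSup_mem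
      (Set.nonempty_iff_ne_empty.2 fun h => hne (by rw [colourKey, h, csSup_empty]; rfl))
      (hbdd (e ⟨i + 1, by omega⟩))
    have hcolM := hcolour M hM hMl (i + 1) (by omega) ((testBit_maskOf M _).2 ⟨by omega, hiM⟩)
    refine ⟨_, ⟨M, hM, rfl⟩, by rwa [size_maskOf he], ?_, ?_⟩
    · rw [hcolM, hcol, pow_succ, mul_comm]
    · have hlt : maskOf e L % 16 < maskOf e M % 16 := by
        rw [← maskOf_mod, ← maskOf_mod, hcol, hcolM]
        exact Nat.pow_lt_pow_right (by norm_num) (by omega)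
      have : maskOf e L / 16 ≤ maskOf e M / 16 := hkM ▸ hle2
      omega
  · intro p hp4 hp9 t ht hrich
    by_contra! ht3
    set_option synthInstance.maxSize 512 in
    have hthree : ∀ t < 16, 2 < size t → ∃ x y z w : Fin 4,
        (x ≠ y ∧ x ≠ z ∧ y ≠ z ∧ w ≠ x ∧ w ≠ y ∧ w ≠ z) ∧
        t.testBit x = true ∧ t.testBit y = true ∧ t.testBit z = true := by decide +kernel
    obtain ⟨x, y, z, w, ⟨hxy, hxz, hyz, hwx, hwy, hwz⟩, htx, hty, htz⟩ :=
      hthree t ht ht3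
    have hmem : ∀ i : Fin 4, e ⟨i, by omega⟩ ∈ l ∩ Set.range e := fun i =>
      ⟨(hel _).2 i.2, _, rfl⟩
    have hinj : ∀ {i j : Fin 4}, i ≠ j → e ⟨i, by omega⟩ ≠ e ⟨j, by omega⟩ :=
      fun hij h => hij (Fin.ext (Fin.mk.inj (he h)))
    have hr : ∀ i : Fin 4, t.testBit i → ∃ L ∈ planeLines, e ⟨p, hp9⟩ ∈ L ∧
        e ⟨i, by omega⟩ ∈ L ∧ 3 ≤ (L ∩ Set.range e).ncard := by
      intro i hti
      obtain ⟨_, ⟨L, hL, rfl⟩, h3, hpL, hiL⟩ := hrich i hti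
      rw [size_maskOf he] at h3
      exact ⟨L, hL, ((testBit_maskOf L p).1 hpL).2, ((testBit_maskOf L i).1 hiL).2, h3⟩
    refine no_three_rich_joins hA1 hl (p := e ⟨p, hp9⟩) ⟨_, rfl⟩
      (fun h => absurd ((hel _).1 h) (not_lt.2 hp4))
      (hmem x) (hmem y) (hmem z) (hmem w) (hinj hxy) (hinj hxz) (hinj hyz)
      (hinj hwx) (hinj hwy) (hinj hwz) ?_
    rintro u (rfl | rfl | rfl)
    exacts [hr x htx, hr y hty, hr z htz]

end
end Mask

/-! ### Choosing the labelling -/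

namespace Mask

theorem range_append {α : Type*} {m n : ℕ} (x : Fin m → α) (y : Fin n → α) :
    Set.range (Fin.append x y) = Set.range x ∪ Set.range y := by
  ext a
  constructor
  · rintro ⟨i, rfl⟩
    refine Fin.addCases (fun i => ?_) (fun i => ?_) i
    · exact Or.inl ⟨i, by simp⟩
    · exact Or.inr ⟨i, by simp⟩
  · rintro (⟨i, rfl⟩ | ⟨i, rfl⟩)
    exacts [⟨Fin.castAdd n i, by simp⟩, ⟨Fin.natAdd m i, by simp⟩]

theorem exists_enumeration {α : Type*} {S : Set α} {n : ℕ} (hn : n ≠ 0) (hS : S.ncard = n) :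
    ∃ x : Fin n → α, x.Injective ∧ Set.range x = S := by
  have hfin : S.Finite := Set.finite_of_ncard_ne_zero (hS ▸ hn)
  rw [Set.ncard_eq_toFinset_card S hfin] at hS
  refine ⟨fun i => (hfin.toFinset.equivFinOfCardEq hS).symm i,
    Subtype.val_injective.comp (Equiv.injective _), ?_⟩
  ext a
  constructor
  · rintro ⟨i, rfl⟩
    exact hfin.mem_toFinset.1 ((hfin.toFinset.equivFinOfCardEq hS).symm i).2
  · intro ha
    exact ⟨hfin.toFinset.equivFinOfCardEq hS ⟨a, by simpa using ha⟩, by simp⟩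

/-- The key depends only on the labels from `4` on, so permuting the labels on `l` preserves it. -/
theorem colourKey_congr {e e' : Fin 9 → Plane} (hr : Set.range e = Set.range e')
    (h : ∀ i : Fin 9, 4 ≤ i.1 → e i = e' i) (l : Set Plane) : colourKey e l = colourKey e' l := by
  have hm : ∀ L, maskOf e L / 16 = maskOf e' L / 16 := by
    intro L
    refine Nat.eq_of_testBit_eq fun j => Bool.eq_iff_iff.2 ?_
    rw [show 16 = 2 ^ 4 from rfl, Nat.testBit_div_two_pow, Nat.testBit_div_two_pow,
      testBit_maskOf, testBit_maskOf]
    exact exists_congr fun hj => by rw [h ⟨_, hj⟩ (Nat.le_add_left _ _)]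
  funext p
  simp only [colourKey, hr, hm]

/-- A labelling as required by `isTraceFamily_lineTrace`. -/
theorem exists_labelling {P l m : Set Plane} (hcard : P.ncard = 9) (h4 : (l ∩ P).ncard = 4)
    (h3 : 3 ≤ (m ∩ (P \ l)).ncard) :
    ∃ e : Fin 9 → Plane, e.Injective ∧ Set.range e = P ∧ (∀ i, e i ∈ l ↔ i.1 < 4) ∧
      (∀ i : Fin 9, 6 ≤ i.1 → e i ∈ m) ∧
      ∀ i j : Fin 9, i ≤ j → j.1 < 4 → colourKey e l (e i) ≤ colourKey e l (e j) := by
  have hP : P.Finite := Set.finite_of_ncard_pos (by omega)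
  have hsum : (l ∩ P).ncard + (P \ l).ncard = 9 := by
    rw [Set.inter_comm, Set.ncard_inter_add_ncard_sdiff_eq_ncard P l hP, hcard]
  obtain ⟨Q, hQ, hQ3⟩ := Set.exists_subset_card_eq h3
  have hQR : Q ⊆ P \ l := hQ.trans Set.inter_subset_right
  have hD : ((P \ l) \ Q).ncard = 2 := by
    rw [Set.ncard_sdiff hQR ((hP.subset Set.sdiff_subset).subset hQR)]
    omega
  obtain ⟨x, hxinj, hx⟩ := exists_enumeration (by norm_num) h4
  obtain ⟨d, hdinj, hd⟩ := exists_enumeration (by norm_num) hD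
  obtain ⟨q, hqinj, hq⟩ := exists_enumeration (by norm_num) hQ3
  set y : Fin 5 → Plane := Fin.append d q with hydef
  have hyinj : y.Injective := Fin.append_injective_iff.2 ⟨hdinj, hqinj, fun i j hij => by
    have h1 : d i ∈ (P \ l) \ Q := hd ▸ Set.mem_range_self i
    exact h1.2 (hij ▸ hq ▸ Set.mem_range_self j)⟩
  have hy : Set.range y = P \ l := by
    rw [hydef, range_append, hd, hq, Set.sdiff_union_of_subset hQR]
  have hlab : ∀ σ : Equiv.Perm (Fin 4), Function.Injective (Fin.append (x ∘ σ) y) ∧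
      Set.range (Fin.append (x ∘ σ) y) = P ∧
      ∀ i : Fin 9, Fin.append (x ∘ σ) y i ∈ l ↔ i.1 < 4 := by
    intro σ
    have hxl : ∀ i, x i ∈ l := fun i => (hx ▸ Set.mem_range_self i : x i ∈ l ∩ P).1
    have hyl : ∀ i, y i ∉ l := fun i => (hy ▸ Set.mem_range_self i : y i ∈ P \ l).2
    refine ⟨Fin.append_injective_iff.2 ⟨hxinj.comp σ.injective, hyinj, fun i j hij => ?_⟩, ?_, ?_⟩
    · exact hyl j (hij ▸ hxl (σ i))
    · rw [range_append, hy, σ.surjective.range_comp, hx, Set.inter_comm, Set.inter_union_sdiff]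
    · intro i
      refine Fin.addCases (m := 4) (n := 5) (fun i => ?_) (fun i => ?_) i
      · rw [Fin.append_left]
        exact iff_of_true (hxl _) i.2
      · rw [Fin.append_right]
        exact iff_of_false (hyl _) (by simp)
  set key : Fin 4 → ℕ := fun i => colourKey (Fin.append x y) l (x i) with hkey
  set σ := Tuple.sort key
  obtain ⟨hinj, hr, hl⟩ := hlab σ
  refine ⟨Fin.append (x ∘ σ) y, hinj, hr, hl, ?_, ?_⟩
  · intro i hi
    have h1 : Fin.append (x ∘ σ) y i = q ⟨i.1 - 6, by omega⟩ := by
      have : i = Fin.natAdd 4 (Fin.natAdd 2 (⟨i.1 - 6, by omega⟩ : Fin 3)) := Fin.ext (by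
        simp; omega)
      conv_lhs => rw [this]
      rw [Fin.append_right, hydef, Fin.append_right]
    rw [h1]
    exact (hQ (hq ▸ Set.mem_range_self _)).1
  · intro i j hij hj
    have hc : colourKey (Fin.append (x ∘ σ) y) l = colourKey (Fin.append x y) l := by
      refine colourKey_congr (hr.trans (hlab (Equiv.refl _)).2.1.symm) (fun i hi => ?_) l
      have : i = Fin.natAdd 4 (⟨i.1 - 4, by omega⟩ : Fin 5) := Fin.ext (by simp; omega)
      rw [this, Fin.append_right, Fin.append_right]
    have hval : ∀ (i : Fin 9) (hi : i.1 < 4),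
        colourKey (Fin.append x y) l (Fin.append (x ∘ σ) y i) = (key ∘ σ) ⟨i.1, hi⟩ := by
      intro i hi
      have : i = Fin.castAdd 5 (⟨i.1, hi⟩ : Fin 4) := rfl
      conv_lhs => rw [this, Fin.append_left]
      rfl
    rw [hc, hval i (lt_of_le_of_lt hij hj), hval j hj]
    exact Tuple.monotone_sort key hij

end Mask

theorem mainTheorem3 (P : Set Plane) (hcard : P.ncard = 9)
    (hfour : ∃ Q ⊆ P, Q.ncard = 4 ∧ Collinear ℝ Q) :
    FamilyShatters (lineUnions 3) P ↔ CondO P ∧ CondA1 P ∧ CondA2 P := by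
  have hP : P.Finite := Set.finite_of_ncard_pos (by omega)
  obtain ⟨Q, hQP, hQ, hcol⟩ := hfour
  obtain ⟨l, hl, h4⟩ := exists_line_of_collinear hP hQP hQ hcol
  have main : CondO P → CondA1 P → (∀ L ∈ planeLines, (L ∩ P).ncard ≤ 4) →
      (CondA2 P ↔ FamilyShatters (lineUnions 3) P) := by
    intro hO hA1 hle
    have hl4 : (l ∩ P).ncard = 4 := le_antisymm (hle l hl) h4
    obtain ⟨m, hm, hm3⟩ := exists_second_line hcard hO hl hl4
    obtain ⟨e, he, rfl, hel, hem, hkey⟩ := Mask.exists_labelling hcard hl4 hm3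
    rw [← Mask.doublyRich_lineTrace_iff he, ← Mask.covers_lineTrace_iff he]
    exact Mask.doublyRich_iff_covers
      (Mask.isTraceFamily_lineTrace he hl hm hel hem hle hA1 hkey) (Mask.pairing_lineTrace he hA1)
  constructor
  · intro h
    have hO := condO_of_shatters h
    have hA1 := condA1_of_shatters h
    exact ⟨hO, hA1, (main hO hA1 fun L hL => ncard_inter_le_four_of_shatters hP h hL).2 h⟩
  · rintro ⟨hO, hA1, hA2⟩
    exact (main hO hA1 fun L hL => ncard_inter_le_four_of_conds hcard hA1 hA2 hL).1 hA2
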